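/- Let $n\ge 2$ be an integer, let $\beta>0$ be the positive solution of $\beta^n=1+\beta+\cdots+\beta^{n-1}$, and let $\lambda_1,\dots,\lambda_n\in\mathbb C$ be the roots of $x^n-(1+x+\cdots+x^{n-1})$, listed with multiplicity so that $|\lambda_1|\ge|\lambda_2|\ge\cdots\ge|\lambda_n|$. For $0\le x<1$ put $$f_\beta(x)=D(\beta)^{-1}\sum_{j=1}^n F_j(x),\qquad F_j=(\beta^j-\beta^{j-1}-\cdots-\beta)\,\chi_{[\beta^{-1}+\cdots+\beta^{-(j-1)},\;\beta^{-1}+\cdots+\beta^{-j})},$$ where $\chi_I$ is the indicator function of $I$ and $D(\beta)=\int_0^1\sum_{j=1}^nF_j(x)\,dx$, so that $\int_0^1 f_\beta(x)\,dx=1$. For $m\in\mathbb N$ let $\Omega_m$ be the set of words $J=(j_1,\dots,j_m)\in\{0,1\}^m$ in which no more than $n-1$ successive digits equal $1$. For $J\in\Omega_m$ let $r(J)$ be the number of successive $1$'s at the end of $J$, and put $L_{J,m}=\sum_{k=1}^m j_k\beta^{-k}$ and $K(J)=\beta^{-1}+\cdots+\beta^{-(n-r(J))}$. For a function $g$ on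 $[0,1)$ and $0\le x<1$ let $$g_m(x)=\beta^{-m}\sum_{J\in\Omega_m}\chi_{[0,K(J))}(x)\,g(L_{J,m}+\beta^{-m}x).$$ Then there are constants $C_1,C_2\ge 0$, depending only on $n$, such that for every probability density $g$ on $[0,1)$ and every $L_g$ with $|g(x)-g(y)|\le L_g|x-y|$ for all $x,y\in[0,1)$, and for all integers $m>2n$ and $m_1,m_2$ with $m_1+m_2=m$, $m_1\ge n-1$ and $m_2>2n-1$, $$\sup_{x\in[0,1)}|g_m(x)-f_\beta(x)|\le C_1\,\beta^{-m_1}L_g+C_2\,(\beta^{-1}|\lambda_2|)^{m_2}.$$ -/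

import Mathlib

open scoped ENNReal

namespace PseudoGolden

/-- The polynomial `X ^ n - (1 + X + ⋯ + X ^ (n - 1))` over `ℂ`. -/
noncomputable def charPoly (n : ℕ) : Polynomial ℂ :=
  Polynomial.X ^ n - ∑ i ∈ Finset.range n, Polynomial.X ^ i

/-- `lam 0, …, lam (n - 1)` lists all `n` roots of `charPoly n`, with multiplicity,
in the order of non-increasing absolute value. -/
structure IsRootOrdering (n : ℕ) (lam : Fin n → ℂ) : Prop where
  roots_eq : (charPoly n).roots = Finset.univ.val.map lam
  antitone_norm : Antitone fun j => ‖lam j‖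

/-- The partial sum `β⁻¹ + β⁻² + ⋯ + β⁻ʲ` (which is `0` for `j = 0`). -/
noncomputable def partialSum (β : ℝ) (j : ℕ) : ℝ :=
  ∑ i ∈ Finset.Icc 1 j, (β ^ i)⁻¹

/-- The binary words of length `m` with no `n` consecutive digits equal to `1`
(the digit `1` is `true`; the letter with index `k : Fin m` is the `(k + 1)`-st digit). -/
def admissible (n m : ℕ) : Set (Fin m → Bool) :=
  {J | ¬ ∃ i : ℕ, i + n ≤ m ∧ ∀ k : Fin m, i ≤ k → (k : ℕ) < i + n → J k = true}

open Classical in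
/-- `admissible n m` as a finite set. -/
noncomputable def Omega (n m : ℕ) : Finset (Fin m → Bool) :=
  Finset.univ.filter fun J => J ∈ admissible n m

/-- The left endpoint `∑ₖ jₖ β⁻ᵏ`, `k = 1, …, m`, of the cylinder interval of the word `J`. -/
noncomputable def leftEnd (β : ℝ) {m : ℕ} (J : Fin m → Bool) : ℝ :=
  ∑ k : Fin m, if J k = true then (β ^ ((k : ℕ) + 1))⁻¹ else 0

open Classical in
/-- The number of successive digits `1` at the end of the word `J`. -/
noncomputable def trailingOnes {m : ℕ} (J : Fin m → Bool) : ℕ :=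
  Nat.findGreatest (fun r => ∀ k : Fin m, m ≤ (k : ℕ) + r → J k = true) m

/-- The scaled length `K(J) = β⁻¹ + ⋯ + β^{-(n - r(J))}` of the cylinder interval of `J`. -/
noncomputable def scaledLength (n : ℕ) (β : ℝ) {m : ℕ} (J : Fin m → Bool) : ℝ :=
  partialSum β (n - trailingOnes J)

/-- `g_m(x) = β⁻ᵐ ∑_{J ∈ Ω_m} χ_{[0, K(J))}(x) g(L_J + β⁻ᵐ x)`. -/
noncomputable def pushDensity (n : ℕ) (β : ℝ) (g : ℝ → ℝ) (m : ℕ) (x : ℝ) : ℝ :=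
  (β ^ m)⁻¹ * ∑ J ∈ Omega n m,
    (Set.Ico 0 (scaledLength n β J)).indicator
      (fun y => g (leftEnd β J + (β ^ m)⁻¹ * y)) x

/-- The step function `F_j`, with value `β ^ j - (β ^ (j - 1) + ⋯ + β)` on
`[β⁻¹ + ⋯ + β^{-(j - 1)}, β⁻¹ + ⋯ + β^{-j})` and `0` elsewhere, for `j ≥ 1`. -/
noncomputable def stepFun (β : ℝ) (j : ℕ) : ℝ → ℝ :=
  (Set.Ico (partialSum β (j - 1)) (partialSum β j)).indicator
    fun _ => β ^ j - ∑ i ∈ Finset.Icc 1 (j - 1), β ^ i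

/-- The normalising constant `D(β)`, which makes the integral of `invDensity` equal to `1`. -/
noncomputable def normConst (n : ℕ) (β : ℝ) : ℝ :=
  ∫ x in Set.Ico (0 : ℝ) 1, ∑ j ∈ Finset.Icc 1 n, stepFun β j x

/-- The invariant density `f_β = D(β)⁻¹ (F_1 + ⋯ + F_n)`. -/
noncomputable def invDensity (n : ℕ) (β : ℝ) (x : ℝ) : ℝ :=
  (∑ j ∈ Finset.Icc 1 n, stepFun β j x) * (normConst n β)⁻¹

/-- `g` is a Lipschitz probability density on `[0, 1)` with Lipschitz constant `L`
(values of `g` outside `[0, 1)` are irrelevant; integrability follows from the Lipschitz bound). -/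
structure IsLipschitzDensity (g : ℝ → ℝ) (L : ℝ) : Prop where
  nonneg : ∀ x ∈ Set.Ico (0 : ℝ) 1, 0 ≤ g x
  integral_eq_one : ∫ x in Set.Ico (0 : ℝ) 1, g x = 1
  lipschitz : ∀ x ∈ Set.Ico (0 : ℝ) 1, ∀ y ∈ Set.Ico (0 : ℝ) 1, |g x - g y| ≤ L * |x - y|

/-- The distance `sup_{x ∈ [0, 1)} |h x - k x|` in `[0, ∞]`. -/
noncomputable def supDist (h k : ℝ → ℝ) : ℝ≥0∞ :=
  ⨆ x ∈ Set.Ico (0 : ℝ) 1, ENNReal.ofReal |h x - k x|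

end PseudoGolden

/-!
On `[0, 1)` the passage from `g` to `g_m` is the `m`-th iterate of the transfer operator `P` of
`x ↦ β x mod 1`, one digit per application, so `g_{m₁ + m₂} = P ^ m₂ g_{m₁}`. Freezing `g` at the
left ends of the cylinder intervals of length `m₁` replaces `g_{m₁}` by a combination of the
indicators `χ_j` of `[0, β⁻¹ + ⋯ + β⁻ʲ)`, at the cost of an error `O(β^{-m₁} L)`.

Since `P χ_j = β⁻¹ (χ_n + χ_{j - 1})`, the number `β ^ m (P ^ m χ_j)(x)` is a sum of terms of the
`n`-step Fibonacci sequence whose initial values are those at `x` of the indicators of the steps of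
`f_β`. The characteristic roots are simple: a double root would be `2 n / (n + 1)`, which is
excluded by divisibility. Hence the `k`-th term of the sequence is `c β ^ k + O(|λ₂| ^ k)`. Pairing
with the coefficients of the quotient of the characteristic polynomial by `X - β` isolates `c`, and
`c β ^ n = f_β(x)`.
-/

namespace PseudoGolden

/-! ### Partial sums and pseudo-golden means -/

section PartialSum

variable {β : ℝ}

theorem partialSum_zero (β : ℝ) : partialSum β 0 = 0 := by simp [partialSum]

theorem partialSum_succ (β : ℝ) (j : ℕ) :
    partialSum β (j + 1) = partialSum β j + (β ^ (j + 1))⁻¹ :=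
  Finset.sum_Icc_succ_top (Nat.le_add_left 1 j) _

theorem partialSum_eq_sum_range (β : ℝ) (j : ℕ) :
    partialSum β j = ∑ i ∈ Finset.range j, (β ^ (i + 1))⁻¹ := by
  induction j with
  | zero => exact partialSum_zero β
  | succ j ih => rw [partialSum_succ, ih, Finset.sum_range_succ]

theorem partialSum_strictMono (hβ : 0 < β) : StrictMono (partialSum β) :=
  strictMono_nat_of_lt_succ fun j => by
    rw [partialSum_succ]
    exact lt_add_of_pos_right _ (by positivity)

theorem partialSum_nonneg (hβ : 0 < β) (j : ℕ) : 0 ≤ partialSum β j :=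
  (partialSum_zero β).ge.trans ((partialSum_strictMono hβ).monotone j.zero_le)

theorem inv_le_partialSum (hβ : 0 < β) {j : ℕ} (hj : 1 ≤ j) : β⁻¹ ≤ partialSum β j := by
  simpa [partialSum] using (partialSum_strictMono hβ).monotone hj

theorem mul_partialSum_succ (hβ : β ≠ 0) (j : ℕ) :
    β * partialSum β (j + 1) = 1 + partialSum β j := by
  rw [partialSum_eq_sum_range, partialSum_eq_sum_range, Finset.sum_range_succ', mul_add,
    Finset.mul_sum, add_comm]
  congr 1
  · simp [hβ]
  · exact Finset.sum_congr rfl fun i _ => by field_simp; ring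

theorem pow_mul_partialSum (hβ : β ≠ 0) (j : ℕ) :
    β ^ j * partialSum β j = ∑ i ∈ Finset.range j, β ^ i := by
  induction j with
  | zero => simp [partialSum_zero]
  | succ j ih =>
    rw [pow_succ, mul_assoc, mul_partialSum_succ hβ, mul_add, ih, mul_one, add_comm,
      Finset.sum_range_succ]

theorem inv_mul_one_add_lt_partialSum_succ_iff (hβ : 0 < β) (j : ℕ) (x : ℝ) :
    β⁻¹ * (1 + x) < partialSum β (j + 1) ↔ x < partialSum β j := by
  rw [inv_mul_lt_iff₀ hβ, mul_partialSum_succ hβ.ne', add_lt_add_iff_left]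

theorem inv_mul_lt_partialSum (hβ : 0 < β) {j : ℕ} (hj : 1 ≤ j) {x : ℝ} (hx : x < 1) :
    β⁻¹ * x < partialSum β j :=
  (mul_lt_of_lt_one_right (inv_pos.2 hβ) hx).trans_le (inv_le_partialSum hβ hj)

end PartialSum

/-- `β` is the `n`-th pseudo-golden mean, the positive root of
`X ^ n - (1 + X + ⋯ + X ^ (n - 1))`. This forces `1 ≤ n`, and `n = 1` gives `β = 1`. -/
structure IsPseudoGolden (n : ℕ) (β : ℝ) : Prop where
  pos : 0 < β
  pow_eq : β ^ n = ∑ i ∈ Finset.range n, β ^ i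

namespace IsPseudoGolden

variable {n : ℕ} {β : ℝ} (hβ : IsPseudoGolden n β)
include hβ

theorem one_le_order : 1 ≤ n := by
  refine Nat.one_le_iff_ne_zero.2 ?_
  rintro rfl
  simpa using hβ.pow_eq

theorem partialSum_eq_one : partialSum β n = 1 :=
  (mul_eq_left₀ (pow_pos hβ.pos n).ne').1
    ((pow_mul_partialSum hβ.pos.ne' n).trans hβ.pow_eq.symm)

theorem partialSum_le_one {j : ℕ} (hj : j ≤ n) : partialSum β j ≤ 1 :=
  hβ.partialSum_eq_one ▸ (partialSum_strictMono hβ.pos).monotone hj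

theorem one_le : 1 ≤ β :=
  (inv_le_one₀ hβ.pos).1
    ((inv_le_partialSum hβ.pos hβ.one_le_order).trans_eq hβ.partialSum_eq_one)

theorem sub_one_eq : β - 1 = partialSum β (n - 1) := by
  have h := mul_partialSum_succ hβ.pos.ne' (n - 1)
  rw [Nat.sub_add_cancel hβ.one_le_order, hβ.partialSum_eq_one, mul_one] at h
  exact sub_eq_of_eq_add' h

theorem le_two : β ≤ 2 := by
  linarith [hβ.sub_one_eq, hβ.partialSum_le_one (Nat.sub_le n 1)]

theorem norm_le {𝕜 : Type*} [NormedDivisionRing 𝕜] {z : 𝕜}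
    (hz : z ^ n = ∑ i ∈ Finset.range n, z ^ i) : ‖z‖ ≤ β := by
  by_contra! h
  have hz0 : 0 < ‖z‖ := hβ.pos.trans h
  have hpow : ‖z‖ ^ n * 1 ≤ ‖z‖ ^ n * partialSum ‖z‖ n := by
    rw [mul_one, pow_mul_partialSum hz0.ne', ← norm_pow, hz]
    exact (norm_sum_le _ _).trans_eq (by simp only [norm_pow])
  have hlt : partialSum ‖z‖ n < partialSum β n :=
    Finset.sum_lt_sum_of_nonempty (Finset.nonempty_Icc.2 hβ.one_le_order) fun i hi =>
      inv_strictAnti₀ (pow_pos hβ.pos i)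
        (pow_lt_pow_left₀ h hβ.pos.le (Nat.one_le_iff_ne_zero.1 (Finset.mem_Icc.1 hi).1))
  exact ((le_of_mul_le_mul_left hpow (by positivity)).trans_lt hlt).ne' hβ.partialSum_eq_one

end IsPseudoGolden

/-! ### Words without `n` consecutive ones -/

section Words

variable {n m : ℕ}

theorem mem_Omega {J : Fin m → Bool} : J ∈ Omega n m ↔ J ∈ admissible n m := by
  simp [Omega]

theorem le_trailingOnes_iff (J : Fin m → Bool) (r : ℕ) :
    r ≤ trailingOnes J ↔ r ≤ m ∧ ∀ k : Fin m, m ≤ (k : ℕ) + r → J k = true := by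
  classical
  let P : ℕ → Prop := fun r => ∀ k : Fin m, m ≤ (k : ℕ) + r → J k = true
  have hP : P (trailingOnes J) := by
    have hP₀ : P 0 := fun k hk => absurd k.isLt hk.not_gt
    exact Nat.findGreatest_spec m.zero_le hP₀
  refine ⟨fun h => ⟨h.trans (Nat.findGreatest_le m), fun k hk => hP k (by omega)⟩, ?_⟩
  rintro ⟨hr, hJ⟩
  exact Nat.le_findGreatest hr hJ

theorem trailingOnes_eq_zero_of_length_zero (J : Fin 0 → Bool) : trailingOnes J = 0 :=
  Nat.le_zero.1 ((le_trailingOnes_iff J _).1 le_rfl).1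

theorem trailingOnes_snoc_true (J : Fin m → Bool) :
    trailingOnes (Fin.snoc J true : Fin (m + 1) → Bool) = trailingOnes J + 1 := by
  refine eq_of_forall_le_iff fun r => ?_
  cases r with
  | zero => simp
  | succ s =>
    rw [le_trailingOnes_iff, Nat.add_le_add_iff_right, Nat.add_le_add_iff_right,
      le_trailingOnes_iff, Fin.forall_fin_succ']
    simp [← add_assoc]

theorem trailingOnes_snoc_false (J : Fin m → Bool) :
    trailingOnes (Fin.snoc J false : Fin (m + 1) → Bool) = 0 := by
  refine Nat.eq_zero_of_not_pos fun h => ?_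
  have hlast := ((le_trailingOnes_iff _ 1).1 h).2 (Fin.last m) (by simp)
  simp at hlast

theorem leftEnd_snoc (β : ℝ) (J : Fin m → Bool) (b : Bool) :
    leftEnd β (Fin.snoc J b : Fin (m + 1) → Bool) =
      leftEnd β J + if b = true then (β ^ (m + 1))⁻¹ else 0 := by
  simp [leftEnd, Fin.sum_univ_castSucc]

theorem trailingOnes_lt_of_mem {J : Fin m → Bool} (hJ : J ∈ admissible n m) :
    trailingOnes J < n := by
  by_contra! h
  obtain ⟨hn, hones⟩ := (le_trailingOnes_iff J n).1 h
  exact hJ ⟨m - n, by omega, fun k hk _ => hones k (by omega)⟩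

theorem snoc_false_mem_admissible_iff (hn : 1 ≤ n) (J : Fin m → Bool) :
    (Fin.snoc J false : Fin (m + 1) → Bool) ∈ admissible n (m + 1) ↔ J ∈ admissible n m := by
  refine not_congr ⟨?_, ?_⟩
  · rintro ⟨i, hi, hones⟩
    have hi' : i + n ≤ m := by
      by_contra! h
      have hlast := hones (Fin.last m) (by simp; omega) (by simp; omega)
      simp at hlast
    exact ⟨i, hi', fun k hk hk' => by simpa using hones k.castSucc hk hk'⟩
  · rintro ⟨i, hi, hones⟩
    refine ⟨i, by omega, Fin.lastCases (fun _ h => ?_) fun k => by simpa using hones k⟩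
    simp only [Fin.val_last] at h
    omega

theorem snoc_true_mem_admissible_iff (J : Fin m → Bool) :
    (Fin.snoc J true : Fin (m + 1) → Bool) ∈ admissible n (m + 1) ↔
      J ∈ admissible n m ∧ trailingOnes J + 1 < n := by
  constructor
  · intro h
    refine ⟨?_, trailingOnes_snoc_true J ▸ trailingOnes_lt_of_mem h⟩
    rintro ⟨i, hi, hones⟩
    exact h ⟨i, by omega, Fin.lastCases (by simp) fun k => by simpa using hones k⟩
  · rintro ⟨hJ, hlt⟩ ⟨i, hi, hones⟩
    by_cases him : i + n ≤ m
    · exact hJ ⟨i, him, fun k hk hk' => by simpa using hones k.castSucc hk hk'⟩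
    · refine hlt.not_ge (Nat.le_add_of_sub_le ((le_trailingOnes_iff J (n - 1)).2
        ⟨by omega, fun k hk => ?_⟩))
      simpa using hones k.castSucc (by simp; omega) (by simp; omega)

theorem sum_Omega_succ {M : Type*} [AddCommMonoid M] (hn : 1 ≤ n)
    (f : (Fin (m + 1) → Bool) → M) :
    ∑ J ∈ Omega n (m + 1), f J = ∑ J ∈ Omega n m,
      (f (Fin.snoc J false) + if trailingOnes J + 1 < n then f (Fin.snoc J true) else 0) := by
  classical
  have hsnoc (b : Bool) (J : Fin m → Bool) :
      Fin.snocEquiv (fun _ : Fin (m + 1) => Bool) (b, J) = Fin.snoc J b := rfl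
  simp only [Omega, Finset.sum_filter]
  rw [← (Fin.snocEquiv fun _ : Fin (m + 1) => Bool).sum_comp, Fintype.sum_prod_type_right]
  refine Finset.sum_congr rfl fun J _ => ?_
  simp only [hsnoc, Fintype.sum_bool, snoc_true_mem_admissible_iff,
    snoc_false_mem_admissible_iff hn]
  by_cases h : J ∈ admissible n m <;> simp [h, add_comm]

end Words

/-! ### The transfer operator of the `β`-transformation -/

section Transfer

variable {β : ℝ}

theorem inv_mul_mem_Ico (hβ : 1 ≤ β) {x : ℝ} (hx : x ∈ Set.Ico (0 : ℝ) 1) :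
    β⁻¹ * x ∈ Set.Ico (0 : ℝ) 1 :=
  ⟨mul_nonneg (inv_nonneg.2 (zero_le_one.trans hβ)) hx.1,
    (mul_le_of_le_one_left hx.1 (inv_le_one_of_one_le₀ hβ)).trans_lt hx.2⟩

theorem inv_mul_one_add_mem_Ico (hβ : 0 < β) {x : ℝ} (hx : x ∈ Set.Ico 0 (β - 1)) :
    β⁻¹ * (1 + x) ∈ Set.Ico (0 : ℝ) 1 :=
  ⟨mul_nonneg (inv_nonneg.2 hβ.le) (add_nonneg zero_le_one hx.1),
    (inv_mul_lt_one₀ hβ).2 (lt_sub_iff_add_lt'.1 hx.2)⟩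

/-- The Perron–Frobenius operator of `x ↦ β x mod 1` on `[0, 1)`, for `1 ≤ β ≤ 2`: the preimages
of `x` are `β⁻¹ x` and, when `x < β - 1`, also `β⁻¹ (1 + x)`. It acts on all functions `ℝ → ℝ`,
but only its values on `[0, 1)` matter, and these depend only on the argument on `[0, 1)`. -/
noncomputable def transfer (β : ℝ) : Module.End ℝ (ℝ → ℝ) where
  toFun g x := β⁻¹ * (g (β⁻¹ * x) + if x < β - 1 then g (β⁻¹ * (1 + x)) else 0)
  map_add' g h := by
    ext x
    simp only [Pi.add_apply]
    split_ifs <;> ring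
  map_smul' c g := by
    ext x
    simp only [Pi.smul_apply, smul_eq_mul, RingHom.id_apply]
    split_ifs <;> ring

theorem transfer_apply (β : ℝ) (g : ℝ → ℝ) (x : ℝ) :
    transfer β g x =
      β⁻¹ * (g (β⁻¹ * x) + if x < β - 1 then g (β⁻¹ * (1 + x)) else 0) :=
  rfl

theorem abs_transfer_le (hβ : 1 ≤ β) {r s : ℝ → ℝ} (h : ∀ x ∈ Set.Ico (0 : ℝ) 1, |r x| ≤ s x) :
    ∀ x ∈ Set.Ico (0 : ℝ) 1, |transfer β r x| ≤ transfer β s x := by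
  intro x hx
  have hβ₀ : 0 < β := zero_lt_one.trans_le hβ
  rw [transfer_apply, transfer_apply, abs_mul, abs_of_pos (inv_pos.2 hβ₀)]
  refine mul_le_mul_of_nonneg_left ((abs_add_le _ _).trans ?_) (inv_pos.2 hβ₀).le
  refine add_le_add (h _ (inv_mul_mem_Ico hβ hx)) ?_
  split_ifs with hxβ
  · exact h _ (inv_mul_one_add_mem_Ico hβ₀ ⟨hx.1, hxβ⟩)
  · exact abs_zero.le

theorem abs_transfer_pow_le (hβ : 1 ≤ β) (m : ℕ) {r s : ℝ → ℝ}
    (h : ∀ x ∈ Set.Ico (0 : ℝ) 1, |r x| ≤ s x) :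
    ∀ x ∈ Set.Ico (0 : ℝ) 1, |(transfer β ^ m) r x| ≤ (transfer β ^ m) s x := by
  induction m with
  | zero => exact h
  | succ m ih =>
    simp only [pow_succ', Module.End.mul_apply]
    exact abs_transfer_le hβ ih

theorem transfer_pow_congr (hβ : 1 ≤ β) (m : ℕ) {r s : ℝ → ℝ}
    (h : Set.EqOn r s (Set.Ico 0 1)) :
    Set.EqOn ((transfer β ^ m) r) ((transfer β ^ m) s) (Set.Ico 0 1) := by
  intro x hx
  have habs := abs_transfer_pow_le hβ m (r := r - s) (s := 0)
    (fun y hy => by rw [Pi.sub_apply, h hy, sub_self, abs_zero, Pi.zero_apply]) x hx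
  rw [map_sub, map_zero, Pi.sub_apply] at habs
  exact sub_eq_zero.1 (abs_nonpos_iff.1 habs)

end Transfer

section TransferIntegral

open MeasureTheory

theorem intervalIntegrable_ite_lt {E : Type*} [NormedAddCommGroup E] {f : ℝ → E} {a b c : ℝ}
    (hab : a ≤ b) (hbc : b ≤ c) (hf : IntervalIntegrable f volume a b) :
    IntervalIntegrable (fun x => if x < b then f x else 0) volume a c := by
  refine (hf.congr_uIoo fun x hx => ?_).trans
    ((IntervalIntegrable.zero (E := E) (μ := volume)).congr_uIoo fun x hx => ?_)
  · rw [Set.uIoo_of_le hab] at hx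
    exact (if_pos hx.2).symm
  · rw [Set.uIoo_of_le hbc] at hx
    exact (if_neg hx.1.not_gt).symm

theorem integral_ite_lt {E : Type*} [NormedAddCommGroup E] [NormedSpace ℝ E] {f : ℝ → E}
    {a b c : ℝ} (hab : a ≤ b) (hbc : b ≤ c) (hf : IntervalIntegrable f volume a b) :
    ∫ x in a..c, (if x < b then f x else 0) = ∫ x in a..b, f x := by
  have hite := intervalIntegrable_ite_lt hab hbc hf
  have hb : b ∈ Set.uIcc a c := Set.mem_uIcc_of_le hab hbc
  have hleft : ∫ x in a..b, (if x < b then f x else 0) = ∫ x in a..b, f x :=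
    intervalIntegral.integral_congr_uIoo fun x hx =>
      if_pos (Set.uIoo_of_le hab ▸ hx : x ∈ Set.Ioo a b).2
  have hright : ∫ x in b..c, (if x < b then f x else 0) = ∫ _ in b..c, (0 : E) :=
    intervalIntegral.integral_congr_uIoo fun x hx =>
      if_neg (Set.uIoo_of_le hbc ▸ hx : x ∈ Set.Ioo b c).1.not_gt
  rw [← intervalIntegral.integral_add_adjacent_intervals
      (hite.mono_set (Set.uIcc_subset_uIcc_left hb))
      (hite.mono_set (Set.uIcc_subset_uIcc_right hb)),
    hleft, hright, intervalIntegral.integral_zero, add_zero]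

variable {β : ℝ} {g : ℝ → ℝ}

theorem intervalIntegrable_comp_inv_mul (hβ : 1 ≤ β) (hg : IntervalIntegrable g volume 0 1) :
    IntervalIntegrable (fun x => g (β⁻¹ * x)) volume 0 1 := by
  have h := hg.comp_mul_left (c := β⁻¹)
  rw [zero_div, one_div, inv_inv] at h
  exact h.mono_set (Set.uIcc_subset_uIcc_left (Set.mem_uIcc_of_le zero_le_one hβ))

theorem intervalIntegrable_comp_inv_mul_one_add (hβ : 1 ≤ β)
    (hg : IntervalIntegrable g volume 0 1) :
    IntervalIntegrable (fun x => g (β⁻¹ * (1 + x))) volume 0 (β - 1) := by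
  have h := (hg.comp_mul_left (c := β⁻¹)).comp_add_left 1
  rw [zero_div, one_div, inv_inv] at h
  refine h.mono_set (Set.uIcc_subset_uIcc_right (Set.mem_uIcc_of_le ?_ ?_)) <;> linarith

theorem intervalIntegrable_transfer (h₁ : 1 ≤ β) (h₂ : β ≤ 2)
    (hg : IntervalIntegrable g volume 0 1) :
    IntervalIntegrable (transfer β g) volume 0 1 :=
  ((intervalIntegrable_comp_inv_mul h₁ hg).add
    (intervalIntegrable_ite_lt (sub_nonneg.2 h₁) (by linarith)
      (intervalIntegrable_comp_inv_mul_one_add h₁ hg))).const_mul β⁻¹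

theorem integral_transfer (h₁ : 1 ≤ β) (h₂ : β ≤ 2) (hg : IntervalIntegrable g volume 0 1) :
    ∫ x in (0 : ℝ)..1, transfer β g x = ∫ x in (0 : ℝ)..1, g x := by
  have hβ₀ : β ≠ 0 := (zero_lt_one.trans_le h₁).ne'
  have h₀ : 0 ≤ β - 1 := sub_nonneg.2 h₁
  have h₁' : β - 1 ≤ 1 := by linarith
  have hmem : β⁻¹ ∈ Set.uIcc (0 : ℝ) 1 :=
    Set.mem_uIcc_of_le (inv_nonneg.2 (zero_le_one.trans h₁)) (inv_le_one_of_one_le₀ h₁)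
  have hbranch := intervalIntegrable_comp_inv_mul_one_add h₁ hg
  have hleft : β⁻¹ * ∫ x in (0 : ℝ)..1, g (β⁻¹ * x) = ∫ x in (0 : ℝ)..β⁻¹, g x := by
    simp
  have hright : β⁻¹ * ∫ x in (0 : ℝ)..β - 1, g (β⁻¹ * (1 + x)) = ∫ x in β⁻¹..1, g x := by
    have h := intervalIntegral.mul_integral_comp_add_mul (f := g) (a := 0) (b := β - 1) β⁻¹ β⁻¹
    have hend : β⁻¹ + β⁻¹ * (β - 1) = 1 := by field_simp; ring
    simpa only [mul_add, mul_one, mul_zero, add_zero, hend] using h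
  simp only [transfer_apply]
  rw [intervalIntegral.integral_const_mul,
    intervalIntegral.integral_add (intervalIntegrable_comp_inv_mul h₁ hg)
      (intervalIntegrable_ite_lt h₀ h₁' hbranch),
    integral_ite_lt h₀ h₁' hbranch, mul_add, hleft, hright]
  exact intervalIntegral.integral_add_adjacent_intervals
    (hg.mono_set (Set.uIcc_subset_uIcc_left hmem)) (hg.mono_set (Set.uIcc_subset_uIcc_right hmem))

theorem intervalIntegrable_transfer_pow (h₁ : 1 ≤ β) (h₂ : β ≤ 2)
    (hg : IntervalIntegrable g volume 0 1) (m : ℕ) :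
    IntervalIntegrable ((transfer β ^ m) g) volume 0 1 := by
  induction m with
  | zero => exact hg
  | succ m ih =>
    rw [pow_succ', Module.End.mul_apply]
    exact intervalIntegrable_transfer h₁ h₂ ih

theorem integral_transfer_pow (h₁ : 1 ≤ β) (h₂ : β ≤ 2) (hg : IntervalIntegrable g volume 0 1)
    (m : ℕ) : ∫ x in (0 : ℝ)..1, (transfer β ^ m) g x = ∫ x in (0 : ℝ)..1, g x := by
  induction m with
  | zero => rfl
  | succ m ih =>
    rw [pow_succ', Module.End.mul_apply,
      integral_transfer h₁ h₂ (intervalIntegrable_transfer_pow h₁ h₂ hg m), ih]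

end TransferIntegral

/-! ### The densities `g_m` as iterates of the transfer operator -/

section PushDensity

variable {n m : ℕ} {β : ℝ} {g : ℝ → ℝ} {J : Fin m → Bool} {x : ℝ}

/-- The contribution of the cylinder of the word `J` to `g_m`, without the factor `β⁻ᵐ`. -/
noncomputable def cylinderTerm (n : ℕ) (β : ℝ) (g : ℝ → ℝ) {m : ℕ} (J : Fin m → Bool) : ℝ → ℝ :=
  (Set.Ico 0 (scaledLength n β J)).indicator fun y => g (leftEnd β J + (β ^ m)⁻¹ * y)

theorem pushDensity_eq_sum_cylinderTerm (n : ℕ) (β : ℝ) (g : ℝ → ℝ) (m : ℕ) (x : ℝ) :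
    pushDensity n β g m x = (β ^ m)⁻¹ * ∑ J ∈ Omega n m, cylinderTerm n β g J x :=
  rfl

namespace IsPseudoGolden

variable (hβ : IsPseudoGolden n β)
include hβ

theorem scaledLength_le_one (J : Fin m → Bool) : scaledLength n β J ≤ 1 :=
  hβ.partialSum_le_one (Nat.sub_le _ _)

theorem scaledLength_nonneg (J : Fin m → Bool) : 0 ≤ scaledLength n β J :=
  partialSum_nonneg hβ.pos _

theorem scaledLength_snoc_false (J : Fin m → Bool) :
    scaledLength n β (Fin.snoc J false : Fin (m + 1) → Bool) = 1 := by
  rw [scaledLength, trailingOnes_snoc_false, Nat.sub_zero, hβ.partialSum_eq_one]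

theorem scaledLength_snoc_true_le (J : Fin m → Bool) :
    scaledLength n β (Fin.snoc J true : Fin (m + 1) → Bool) ≤ β - 1 := by
  rw [scaledLength, trailingOnes_snoc_true, hβ.sub_one_eq]
  exact (partialSum_strictMono hβ.pos).monotone (by omega)

theorem inv_mul_mem_Ico_scaledLength (hJ : J ∈ admissible n m) (hx : x ∈ Set.Ico (0 : ℝ) 1) :
    β⁻¹ * x ∈ Set.Ico 0 (scaledLength n β J) :=
  ⟨(inv_mul_mem_Ico hβ.one_le hx).1,
    inv_mul_lt_partialSum hβ.pos (Nat.sub_pos_of_lt (trailingOnes_lt_of_mem hJ)) hx.2⟩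

theorem inv_mul_one_add_lt_scaledLength_iff (hJ : J ∈ admissible n m) :
    β⁻¹ * (1 + x) < scaledLength n β J ↔
      x < scaledLength n β (Fin.snoc J true : Fin (m + 1) → Bool) := by
  have hr := trailingOnes_lt_of_mem hJ
  rw [scaledLength, scaledLength, trailingOnes_snoc_true,
    ← inv_mul_one_add_lt_partialSum_succ_iff hβ.pos (n - (trailingOnes J + 1)) x,
    show n - (trailingOnes J + 1) + 1 = n - trailingOnes J by omega]

theorem cylinderTerm_snoc_false (hJ : J ∈ admissible n m) (hx : x ∈ Set.Ico (0 : ℝ) 1) :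
    cylinderTerm n β g (Fin.snoc J false : Fin (m + 1) → Bool) x =
      cylinderTerm n β g J (β⁻¹ * x) := by
  rw [cylinderTerm, cylinderTerm, hβ.scaledLength_snoc_false, Set.indicator_of_mem hx,
    Set.indicator_of_mem (hβ.inv_mul_mem_Ico_scaledLength hJ hx), leftEnd_snoc]
  simp only [Bool.false_eq_true, if_false, add_zero]
  congr 2
  ring

theorem cylinderTerm_snoc_true (hJ : J ∈ admissible n m) (hx : 0 ≤ x) :
    (if trailingOnes J + 1 < n then
        cylinderTerm n β g (Fin.snoc J true : Fin (m + 1) → Bool) x else 0) =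
      if x < β - 1 then cylinderTerm n β g J (β⁻¹ * (1 + x)) else 0 := by
  have hx' : 0 ≤ β⁻¹ * (1 + x) :=
    mul_nonneg (inv_nonneg.2 hβ.pos.le) (add_nonneg zero_le_one hx)
  simp only [cylinderTerm, Set.indicator, Set.mem_Ico, hx, hx', true_and,
    hβ.inv_mul_one_add_lt_scaledLength_iff hJ]
  by_cases hlt : x < scaledLength n β (Fin.snoc J true : Fin (m + 1) → Bool)
  · have hr : trailingOnes J + 1 < n := by
      by_contra! hr
      rw [scaledLength, trailingOnes_snoc_true, Nat.sub_eq_zero_of_le hr, partialSum_zero] at hlt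
      exact hlt.not_ge hx
    simp only [hlt, hr, hlt.trans_le (hβ.scaledLength_snoc_true_le J), if_true, leftEnd_snoc]
    congr 1
    ring
  · simp only [hlt, if_false, ite_self]

theorem pushDensity_zero (hx : x ∈ Set.Ico (0 : ℝ) 1) : pushDensity n β g 0 x = g x := by
  have hOmega : Omega n 0 = Finset.univ := by
    ext J
    simp only [mem_Omega, Finset.mem_univ, iff_true]
    rintro ⟨i, hi, -⟩
    exact (hβ.one_le_order.trans ((Nat.le_add_left n i).trans hi)).not_gt zero_lt_one
  simp [pushDensity, hOmega, scaledLength, trailingOnes_eq_zero_of_length_zero,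
    hβ.partialSum_eq_one, leftEnd, Set.indicator_of_mem hx]

theorem pushDensity_succ (m : ℕ) (hx : x ∈ Set.Ico (0 : ℝ) 1) :
    pushDensity n β g (m + 1) x = transfer β (pushDensity n β g m) x := by
  have hsum : ∑ J ∈ Omega n (m + 1), cylinderTerm n β g J x =
      ∑ J ∈ Omega n m, (cylinderTerm n β g J (β⁻¹ * x) +
        if x < β - 1 then cylinderTerm n β g J (β⁻¹ * (1 + x)) else 0) := by
    rw [sum_Omega_succ hβ.one_le_order]
    refine Finset.sum_congr rfl fun J hJ => ?_
    rw [hβ.cylinderTerm_snoc_false (mem_Omega.1 hJ) hx,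
      hβ.cylinderTerm_snoc_true (mem_Omega.1 hJ) hx.1]
  simp only [transfer_apply, pushDensity_eq_sum_cylinderTerm, hsum, Finset.sum_add_distrib,
    pow_succ, mul_inv]
  split_ifs
  · ring
  · rw [Finset.sum_const_zero]
    ring

theorem pushDensity_eq_transfer_pow (g : ℝ → ℝ) (m : ℕ) :
    Set.EqOn (pushDensity n β g m) ((transfer β ^ m) g) (Set.Ico 0 1) := by
  induction m with
  | zero => exact fun x hx => hβ.pushDensity_zero hx
  | succ m ih =>
    intro x hx
    rw [hβ.pushDensity_succ m hx, pow_succ', Module.End.mul_apply]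
    simpa only [pow_one] using transfer_pow_congr hβ.one_le 1 ih hx

theorem leftEnd_add_mem_Ico (hJ : J ∈ admissible n m)
    (hx : x ∈ Set.Ico 0 (scaledLength n β J)) :
    leftEnd β J + (β ^ m)⁻¹ * x ∈ Set.Ico (0 : ℝ) 1 := by
  induction m generalizing x with
  | zero => simpa [leftEnd] using Set.Ico_subset_Ico_right (hβ.scaledLength_le_one J) hx
  | succ m ih =>
    obtain ⟨J, b, rfl⟩ : ∃ J' b, J = Fin.snoc J' b := ⟨_, _, (Fin.snoc_init_self J).symm⟩
    rw [leftEnd_snoc, pow_succ, mul_inv, mul_assoc]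
    cases b with
    | false =>
      rw [snoc_false_mem_admissible_iff hβ.one_le_order] at hJ
      rw [hβ.scaledLength_snoc_false] at hx
      simpa using ih hJ (hβ.inv_mul_mem_Ico_scaledLength hJ hx)
    | true =>
      rw [snoc_true_mem_admissible_iff] at hJ
      have hnonneg : 0 ≤ β⁻¹ * (1 + x) :=
        mul_nonneg (inv_nonneg.2 hβ.pos.le) (add_nonneg zero_le_one hx.1)
      have hmem := ih hJ.1 ⟨hnonneg, (hβ.inv_mul_one_add_lt_scaledLength_iff hJ.1).2 hx.2⟩
      rwa [mul_add, mul_one, mul_add, ← add_assoc] at hmem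

end IsPseudoGolden

end PushDensity

/-! ### Linear recurrences with simple characteristic roots -/

section LinearRecurrence

open Matrix

/-- The coefficients `a` with `u k = ∑ i, a i * lam i ^ k` for `k < n`, when the `lam i` are
distinct: the solution of the (transposed) Vandermonde system. -/
noncomputable def rootCoeff {K : Type*} [Field K] {n : ℕ} (lam : Fin n → K) (u : ℕ → K) :
    Fin n → K :=
  (vandermonde lam)ᵀ⁻¹ *ᵥ fun k => u k

theorem sum_rootCoeff_mul_pow {K : Type*} [Field K] {n : ℕ} {lam : Fin n → K}
    (hinj : Function.Injective lam) (u : ℕ → K) (k : Fin n) :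
    ∑ i, rootCoeff lam u i * lam i ^ (k : ℕ) = u k := by
  have hdet : IsUnit (vandermonde lam)ᵀ.det := by
    rw [det_transpose, isUnit_iff_ne_zero]
    exact det_vandermonde_ne_zero_iff.2 hinj
  have hmul : (vandermonde lam)ᵀ *ᵥ rootCoeff lam u = fun k : Fin n => u k := by
    rw [rootCoeff, mulVec_mulVec, mul_nonsing_inv _ hdet, one_mulVec]
  rw [← congrFun hmul k]
  simp [mulVec, dotProduct, vandermonde, mul_comm]

theorem eq_sum_rootCoeff_mul_pow {K : Type*} [Field K] {E : LinearRecurrence K}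
    {lam : Fin E.order → K} (hinj : Function.Injective lam)
    (hroot : ∀ i, E.charPoly.IsRoot (lam i)) {u : ℕ → K} (hu : E.IsSolution u) (k : ℕ) :
    u k = ∑ i, rootCoeff lam u i * lam i ^ k := by
  have hsol : (∑ i, rootCoeff lam u i • fun k => lam i ^ k) ∈ E.solSpace :=
    Submodule.sum_mem _ fun i _ =>
      Submodule.smul_mem _ _ ((E.geom_sol_iff_root_charPoly (lam i)).2 (hroot i))
  have heq := (E.eq_iff_eqOn_range_order u _ hu hsol).2 fun k hk => by
    rw [Finset.sum_apply, ← sum_rootCoeff_mul_pow hinj u ⟨k, Finset.mem_range.1 hk⟩]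
    rfl
  simpa using congrFun heq k

theorem norm_rootCoeff_le {K : Type*} [NormedField K] {n : ℕ} (lam : Fin n → K) {u : ℕ → K}
    (hu : ∀ k < n, ‖u k‖ ≤ 1) (i : Fin n) :
    ‖rootCoeff lam u i‖ ≤ ∑ j, ‖(vandermonde lam)ᵀ⁻¹ i j‖ := by
  rw [rootCoeff, mulVec, dotProduct]
  refine (norm_sum_le _ _).trans (Finset.sum_le_sum fun j _ => ?_)
  rw [norm_mul]
  exact mul_le_of_le_one_right (norm_nonneg _) (hu j j.isLt)

theorem exists_norm_sub_rootCoeff_mul_pow_le {K : Type*} [NormedField K] {E : LinearRecurrence K}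
    {lam : Fin E.order → K} (hinj : Function.Injective lam)
    (hroot : ∀ i, E.charPoly.IsRoot (lam i)) {i₀ : Fin E.order} {ρ : ℝ}
    (hρ : ∀ i ≠ i₀, ‖lam i‖ ≤ ρ) :
    ∃ C : ℝ, 0 ≤ C ∧ ∀ u, E.IsSolution u → (∀ k < E.order, ‖u k‖ ≤ 1) → ∀ k,
      ‖u k - rootCoeff lam u i₀ * lam i₀ ^ k‖ ≤ C * ρ ^ k := by
  classical
  refine ⟨∑ i ∈ Finset.univ.erase i₀, ∑ j, ‖(vandermonde lam)ᵀ⁻¹ i j‖, by positivity,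
    fun u hu hu₁ k => ?_⟩
  rw [eq_sum_rootCoeff_mul_pow hinj hroot hu k, ← Finset.add_sum_erase _ _ (Finset.mem_univ i₀),
    add_sub_cancel_left, Finset.sum_mul]
  refine (norm_sum_le _ _).trans (Finset.sum_le_sum fun i hi => ?_)
  rw [norm_mul, norm_pow]
  exact mul_le_mul (norm_rootCoeff_le lam hu₁ i)
    (pow_le_pow_left₀ (norm_nonneg _) (hρ i (Finset.ne_of_mem_erase hi)) k) (by positivity)
    (by positivity)

end LinearRecurrence

/-! ### The roots of the characteristic polynomial -/

section Roots

/-- The `n`-step Fibonacci recurrence `u (k + n) = u k + u (k + 1) + ⋯ + u (k + n - 1)`. -/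
abbrev nbonacci (R : Type*) [CommSemiring R] (n : ℕ) : LinearRecurrence R where
  order := n
  coeffs _ := 1

theorem isSolution_nbonacci_iff {R : Type*} [CommSemiring R] {n : ℕ} {u : ℕ → R} :
    (nbonacci R n).IsSolution u ↔ ∀ k, u (k + n) = ∑ i ∈ Finset.range n, u (k + i) := by
  simp only [LinearRecurrence.IsSolution, one_mul, Finset.sum_range]

variable {n : ℕ} {lam : Fin n → ℂ}

theorem charPoly_eq_charPoly_nbonacci (n : ℕ) : charPoly n = (nbonacci ℂ n).charPoly := by
  simp [charPoly, LinearRecurrence.charPoly, Polynomial.X_pow_eq_monomial, Finset.sum_range]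

theorem charPoly_ne_zero (n : ℕ) : charPoly n ≠ 0 :=
  charPoly_eq_charPoly_nbonacci n ▸ (nbonacci ℂ n).charPoly_monic.ne_zero

theorem isRoot_charPoly_iff {z : ℂ} :
    (charPoly n).IsRoot z ↔ z ^ n = ∑ i ∈ Finset.range n, z ^ i := by
  simp [Polynomial.IsRoot, charPoly, Polynomial.eval_finsetSum, sub_eq_zero]

theorem sub_one_mul_charPoly (n : ℕ) :
    (Polynomial.X - 1) * charPoly n = Polynomial.X ^ (n + 1) - 2 * Polynomial.X ^ n + 1 := by
  rw [charPoly, mul_sub, mul_comm _ (Finset.sum _ _), geom_sum_mul]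
  ring

theorem pow_mul_two_sub_of_isRoot {z : ℂ} (hz : (charPoly n).IsRoot z) : z ^ n * (2 - z) = 1 := by
  have h := congrArg (Polynomial.eval z) (sub_one_mul_charPoly n)
  simp only [Polynomial.eval_mul, hz.eq_zero, mul_zero, Polynomial.eval_add, Polynomial.eval_sub,
    Polynomial.eval_pow, Polynomial.eval_X, Polynomial.eval_ofNat, Polynomial.eval_one] at h
  linear_combination h

theorem add_one_mul_of_isRoot_derivative {z : ℂ} (hn : n ≠ 0) (hz : (charPoly n).IsRoot z)
    (hz' : (charPoly n).derivative.IsRoot z) : (n + 1) * z = 2 * n := by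
  obtain ⟨k, rfl⟩ := Nat.exists_eq_succ_of_ne_zero hn
  have hz₀ : z ≠ 0 := by
    rintro rfl
    simpa using pow_mul_two_sub_of_isRoot hz
  have h := congrArg (fun p => p.derivative.eval z) (sub_one_mul_charPoly (k + 1))
  simp only [Polynomial.derivative_mul, Polynomial.derivative_sub, Polynomial.derivative_X,
    Polynomial.derivative_one, Polynomial.derivative_X_pow_succ,
    Polynomial.derivative_ofNat, Polynomial.eval_add, Polynomial.eval_mul, Polynomial.eval_sub,
    Polynomial.eval_X, Polynomial.eval_one, Polynomial.eval_pow, Polynomial.eval_natCast,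
    Polynomial.eval_ofNat, hz.eq_zero, hz'.eq_zero, Nat.cast_add, Nat.cast_one, map_add,
    map_natCast, map_one, mul_zero, zero_mul, add_zero, zero_add, sub_zero] at h
  refine mul_right_cancel₀ (pow_ne_zero k hz₀) ?_
  push_cast
  linear_combination -h

theorem two_mul_pow_ne (hn : 2 ≤ n) : 2 * (2 * n) ^ n ≠ (n + 1) ^ (n + 1) := by
  intro h
  have hdvd : n ∣ (n + 1) ^ (n + 1) := by
    rw [← h]
    exact (dvd_pow (Nat.dvd_mul_left n 2) (by omega)).mul_left 2
  have hcop : Nat.Coprime n ((n + 1) ^ (n + 1)) := by simp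
  have := hcop.eq_one_of_dvd hdvd
  omega

theorem nodup_roots_charPoly (hn : 2 ≤ n) : (charPoly n).roots.Nodup := by
  classical
  refine Multiset.nodup_iff_count_le_one.2 fun z => ?_
  rw [Polynomial.count_roots]
  by_contra! h
  obtain ⟨hz, hz'⟩ :=
    (Polynomial.one_lt_rootMultiplicity_iff_isRoot (charPoly_ne_zero n)).1 h
  have hmul := add_one_mul_of_isRoot_derivative (by omega) hz hz'
  have hpow := pow_mul_two_sub_of_isRoot hz
  have hsub : (n + 1) * (2 - z) = 2 := by linear_combination -hmul
  refine two_mul_pow_ne hn ?_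
  have heq : (2 : ℂ) * (2 * n) ^ n = (n + 1) ^ (n + 1) := by
    calc (2 : ℂ) * (2 * n) ^ n = ((n + 1) * (2 - z)) * ((n + 1) * z) ^ n := by rw [hsub, hmul]
      _ = (n + 1) ^ (n + 1) * (z ^ n * (2 - z)) := by
        rw [mul_pow]
        ring
      _ = (n + 1) ^ (n + 1) := by rw [hpow, mul_one]
  exact_mod_cast heq

theorem IsRootOrdering.injective (hlam : IsRootOrdering n lam) (hn : 2 ≤ n) :
    Function.Injective lam := by
  have hnodup := hlam.roots_eq ▸ nodup_roots_charPoly hn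
  exact fun i j => Multiset.inj_on_of_nodup_map hnodup i (by simp) j (by simp)

theorem IsRootOrdering.mem_range_iff (hlam : IsRootOrdering n lam) {z : ℂ} :
    z ∈ Set.range lam ↔ (charPoly n).IsRoot z := by
  rw [← Polynomial.mem_roots (charPoly_ne_zero n), hlam.roots_eq]
  simp

theorem IsRootOrdering.isRoot (hlam : IsRootOrdering n lam) (i : Fin n) :
    (charPoly n).IsRoot (lam i) :=
  hlam.mem_range_iff.1 ⟨i, rfl⟩

theorem IsRootOrdering.norm_le (hlam : IsRootOrdering n lam) {β : ℝ} (hβ : IsPseudoGolden n β)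
    (i : Fin n) : ‖lam i‖ ≤ β :=
  hβ.norm_le (isRoot_charPoly_iff.1 (hlam.isRoot i))

theorem IsRootOrdering.exists_eq (hlam : IsRootOrdering n lam) {β : ℝ}
    (hβ : IsPseudoGolden n β) : ∃ i, lam i = β :=
  hlam.mem_range_iff.2 (isRoot_charPoly_iff.2 (by exact_mod_cast hβ.pow_eq))

theorem IsRootOrdering.norm_le_of_ne (hlam : IsRootOrdering n lam) {β : ℝ}
    (hβ : IsPseudoGolden n β) (hn : 2 ≤ n) {i j : Fin n} (hi : lam i = β) (hj : j ≠ i) :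
    ‖lam j‖ ≤ ‖lam ⟨1, hn⟩‖ := by
  rcases Nat.eq_zero_or_pos j with hj₀ | hj₀
  · have hle : (⟨1, hn⟩ : Fin n) ≤ i :=
      Nat.one_le_iff_ne_zero.2 fun hi₀ => hj (Fin.ext (hj₀.trans hi₀.symm))
    calc ‖lam j‖ ≤ β := hlam.norm_le hβ j
      _ = ‖lam i‖ := by rw [hi, Complex.norm_of_nonneg hβ.pos.le]
      _ ≤ ‖lam ⟨1, hn⟩‖ := hlam.antitone_norm hle
  · exact hlam.antitone_norm (Fin.mk_le_of_le_val hj₀)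

end Roots

/-! ### The dominant term of an `n`-step Fibonacci sequence -/

section DominantCoeff

variable {n : ℕ} {β : ℝ}

theorem sub_mul_sum_partialSum (hβ : β ≠ 0) (z : ℂ) (N : ℕ) :
    (z - β) * ∑ k ∈ Finset.range N, (partialSum β (k + 1) : ℂ) * z ^ k =
      partialSum β N * z ^ N - ∑ k ∈ Finset.range N, z ^ k := by
  induction N with
  | zero => simp [partialSum_zero]
  | succ N ih =>
    have h : (β : ℂ) * partialSum β (N + 1) = 1 + partialSum β N := by
      exact_mod_cast mul_partialSum_succ hβ N
    rw [Finset.sum_range_succ, mul_add, ih, Finset.sum_range_succ]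
    linear_combination (-z ^ N) * h

theorem sum_partialSum_mul_pow_eq_zero (hβ : IsPseudoGolden n β) {z : ℂ}
    (hz : (charPoly n).IsRoot z) (hne : z ≠ β) :
    ∑ k ∈ Finset.range n, (partialSum β (k + 1) : ℂ) * z ^ k = 0 := by
  have h := sub_mul_sum_partialSum hβ.pos.ne' z n
  rw [hβ.partialSum_eq_one, Complex.ofReal_one, one_mul, isRoot_charPoly_iff.1 hz, sub_self] at h
  exact (mul_eq_zero.1 h).resolve_left (sub_ne_zero.2 hne)

/-- The value at `β` of the quotient of the characteristic polynomial by `X - β`; the coefficients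
of this quotient are the partial sums `β⁻¹ + ⋯ + β^{-(k + 1)}`. -/
noncomputable def weight (n : ℕ) (β : ℝ) : ℝ :=
  ∑ k ∈ Finset.range n, partialSum β (k + 1) * β ^ k

theorem weight_pos (hn : n ≠ 0) (hβ : 0 < β) : 0 < weight n β :=
  Finset.sum_pos (fun k _ => mul_pos
    ((inv_pos.2 hβ).trans_le (inv_le_partialSum hβ (Nat.le_add_left 1 k))) (pow_pos hβ k))
    (Finset.nonempty_range_iff.2 hn)

/-- The coefficient of `β ^ k` in the expansion of an `n`-step Fibonacci sequence `u` in powers of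
the characteristic roots: pairing with the coefficients of the quotient of the characteristic
polynomial by `X - β` kills the powers of all the other roots. -/
noncomputable def dominantCoeff (n : ℕ) (β : ℝ) (u : ℕ → ℝ) : ℝ :=
  (∑ k ∈ Finset.range n, partialSum β (k + 1) * u k) / weight n β

theorem ofReal_dominantCoeff (hβ : IsPseudoGolden n β) (hn : 2 ≤ n) {lam : Fin n → ℂ}
    (hlam : IsRootOrdering n lam) {i₀ : Fin n} (hi₀ : lam i₀ = β) {u : ℕ → ℝ}
    (hu : (nbonacci ℂ n).IsSolution fun k => (u k : ℂ)) :
    (dominantCoeff n β u : ℂ) = rootCoeff lam (fun k => (u k : ℂ)) i₀ := by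
  set a := rootCoeff lam fun k => (u k : ℂ)
  have hexp (k : ℕ) : (u k : ℂ) = ∑ i, a i * lam i ^ k :=
    eq_sum_rootCoeff_mul_pow (hlam.injective hn)
      (fun i => charPoly_eq_charPoly_nbonacci n ▸ hlam.isRoot i) hu k
  have hW : (weight n β : ℂ) ≠ 0 := by exact_mod_cast (weight_pos (by omega) hβ.pos).ne'
  have hcross (i : Fin n) (hi : i ≠ i₀) :
      a i * ∑ k ∈ Finset.range n, (partialSum β (k + 1) : ℂ) * lam i ^ k = 0 := by
    rw [sum_partialSum_mul_pow_eq_zero hβ (hlam.isRoot i)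
      fun h => hi (hlam.injective hn (h.trans hi₀.symm)), mul_zero]
  rw [dominantCoeff, Complex.ofReal_div, div_eq_iff hW]
  calc ((∑ k ∈ Finset.range n, partialSum β (k + 1) * u k : ℝ) : ℂ)
      = ∑ i, a i * ∑ k ∈ Finset.range n, (partialSum β (k + 1) : ℂ) * lam i ^ k := by
        push_cast
        simp only [hexp, Finset.mul_sum]
        rw [Finset.sum_comm]
        simp only [mul_left_comm]
    _ = a i₀ * weight n β := by
        rw [Finset.sum_eq_single i₀ (fun i _ => hcross i) (by simp), hi₀, weight]
        push_cast
        rfl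

theorem exists_abs_sub_dominantCoeff_le (hβ : IsPseudoGolden n β) (hn : 2 ≤ n) {lam : Fin n → ℂ}
    (hlam : IsRootOrdering n lam) :
    ∃ C : ℝ, 0 ≤ C ∧ ∀ u : ℕ → ℝ, (nbonacci ℝ n).IsSolution u → (∀ k < n, |u k| ≤ 1) → ∀ k,
      |u k - dominantCoeff n β u * β ^ k| ≤ C * ‖lam ⟨1, hn⟩‖ ^ k := by
  obtain ⟨i₀, hi₀⟩ := hlam.exists_eq hβ
  obtain ⟨C, hC, hbound⟩ := exists_norm_sub_rootCoeff_mul_pow_le (E := nbonacci ℂ n)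
    (hlam.injective hn) (fun i => charPoly_eq_charPoly_nbonacci n ▸ hlam.isRoot i)
    (fun i hi => hlam.norm_le_of_ne hβ hn hi₀ hi)
  refine ⟨C, hC, fun u hu hu₁ k => ?_⟩
  have hu' : (nbonacci ℂ n).IsSolution fun k => (u k : ℂ) := by
    rw [isSolution_nbonacci_iff] at hu ⊢
    exact_mod_cast hu
  have h := hbound _ hu' (fun k hk => by simpa using hu₁ k hk) k
  rw [← ofReal_dominantCoeff hβ hn hlam hi₀ hu', hi₀] at h
  rwa [← Complex.ofReal_pow, ← Complex.ofReal_mul, ← Complex.ofReal_sub, Complex.norm_real,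
    Real.norm_eq_abs] at h

end DominantCoeff

/-! ### The transfer operator on indicator functions -/

section Atom

variable {n j k : ℕ} {β x : ℝ}

/-- The indicator function of `[β⁻¹ + ⋯ + β⁻ʲ, β⁻¹ + ⋯ + β^{-(j + 1)})`, which carries the step
function `F_{j + 1}`. -/
noncomputable def atom (β : ℝ) (j : ℕ) : ℝ → ℝ :=
  (Set.Ico (partialSum β j) (partialSum β (j + 1))).indicator 1

theorem abs_atom_le_one (β : ℝ) (j : ℕ) (x : ℝ) : |atom β j x| ≤ 1 := by
  rw [atom, Set.indicator_apply]
  split_ifs <;> simp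

theorem sum_atom (hβ : 0 < β) (j : ℕ) (x : ℝ) :
    ∑ i ∈ Finset.range j, atom β i x = (Set.Ico 0 (partialSum β j)).indicator 1 x := by
  induction j with
  | zero => simp [partialSum_zero]
  | succ j ih =>
    have hle := (partialSum_strictMono hβ).monotone j.le_succ
    rw [Finset.sum_range_succ, ih, atom, ← Set.Ico_union_Ico_eq_Ico (partialSum_nonneg hβ j) hle,
      Set.indicator_union_of_disjoint Set.Ico_disjoint_Ico_same]

/-- The `n`-step Fibonacci sequence starting with the values at `x` of the atoms
`atom β (n - 1), …, atom β 0`. -/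
noncomputable def atomSeq (n : ℕ) (β x : ℝ) : ℕ → ℝ :=
  (nbonacci ℝ n).mkSol fun k => atom β (n - 1 - k) x

theorem isSolution_atomSeq (n : ℕ) (β x : ℝ) : (nbonacci ℝ n).IsSolution (atomSeq n β x) :=
  (nbonacci ℝ n).is_sol_mkSol _

theorem atomSeq_of_lt (hk : k < n) (β x : ℝ) : atomSeq n β x k = atom β (n - 1 - k) x :=
  (nbonacci ℝ n).mkSol_eq_init _ ⟨k, hk⟩

theorem atomSeq_add (m : ℕ) (β x : ℝ) :
    atomSeq n β x (m + n) = ∑ i ∈ Finset.range n, atomSeq n β x (m + (n - 1 - i)) := by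
  rw [isSolution_nbonacci_iff.1 (isSolution_atomSeq n β x),
    Finset.sum_range_reflect (fun i => atomSeq n β x (m + i))]

namespace IsPseudoGolden

variable (hβ : IsPseudoGolden n β)
include hβ

theorem transfer_indicator_Ico (hj : j < n) (hx : x ∈ Set.Ico (0 : ℝ) 1) :
    transfer β ((Set.Ico 0 (partialSum β (j + 1))).indicator 1) x =
      β⁻¹ * ((Set.Ico 0 (partialSum β n)).indicator 1 x +
        (Set.Ico 0 (partialSum β j)).indicator 1 x) := by
  have hx₀ : 0 ≤ x := hx.1
  have hx' : 0 ≤ β⁻¹ * (1 + x) :=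
    mul_nonneg (inv_nonneg.2 hβ.pos.le) (add_nonneg zero_le_one hx₀)
  have hmem : β⁻¹ * x ∈ Set.Ico 0 (partialSum β (j + 1)) :=
    ⟨(inv_mul_mem_Ico hβ.one_le hx).1, inv_mul_lt_partialSum hβ.pos (Nat.le_add_left 1 j) hx.2⟩
  have hle : partialSum β j ≤ β - 1 :=
    hβ.sub_one_eq ▸ (partialSum_strictMono hβ.pos).monotone (by omega)
  rw [transfer_apply, hβ.partialSum_eq_one, Set.indicator_of_mem hx, Set.indicator_of_mem hmem]
  congr 2
  simp only [Set.indicator, Set.mem_Ico, hx₀, hx', true_and,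
    inv_mul_one_add_lt_partialSum_succ_iff hβ.pos]
  by_cases h : x < partialSum β j
  · simp [h, h.trans_le hle]
  · simp [h]

theorem transfer_pow_succ_indicator_Ico (m : ℕ) (hj : j < n) (hx : x ∈ Set.Ico (0 : ℝ) 1) :
    (transfer β ^ (m + 1)) ((Set.Ico 0 (partialSum β (j + 1))).indicator 1) x =
      β⁻¹ * ((transfer β ^ m) ((Set.Ico 0 (partialSum β n)).indicator 1) x +
        (transfer β ^ m) ((Set.Ico 0 (partialSum β j)).indicator 1) x) := by
  rw [pow_succ, Module.End.mul_apply, transfer_pow_congr hβ.one_le m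
    (s := β⁻¹ • ((Set.Ico 0 (partialSum β n)).indicator 1 +
      (Set.Ico 0 (partialSum β j)).indicator 1))
    (fun y hy => hβ.transfer_indicator_Ico hj hy) hx, map_smul, map_add]
  rfl

theorem transfer_pow_indicator_Ico (m : ℕ) (hj : j ≤ n) (hx : x ∈ Set.Ico (0 : ℝ) 1) :
    (transfer β ^ m) ((Set.Ico 0 (partialSum β j)).indicator 1) x =
      (β ^ m)⁻¹ * ∑ i ∈ Finset.range j, atomSeq n β x (m + (n - 1 - i)) := by
  induction m generalizing j with
  | zero =>
    rw [pow_zero, Module.End.one_apply, pow_zero, inv_one, one_mul, ← sum_atom hβ.pos]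
    refine Finset.sum_congr rfl fun i hi => ?_
    have hi := Finset.mem_range.1 hi
    rw [zero_add, atomSeq_of_lt (by omega), show n - 1 - (n - 1 - i) = i by omega]
  | succ m ih =>
    cases j with
    | zero =>
      rw [partialSum_zero, Set.Ico_self, Set.indicator_empty', map_zero, Pi.zero_apply,
        Finset.sum_range_zero, mul_zero]
    | succ j =>
      rw [hβ.transfer_pow_succ_indicator_Ico m hj hx, ih le_rfl, ih (by omega), ← atomSeq_add,
        Finset.sum_range_succ', ← mul_add, ← mul_assoc, ← mul_inv, ← pow_succ',
        add_comm (atomSeq n β x _)]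
      congr 2
      · refine Finset.sum_congr rfl fun i hi => ?_
        have hi := Finset.mem_range.1 hi
        congr 1
        omega
      · congr 1
        omega

end IsPseudoGolden

end Atom

/-! ### The invariant density -/

section InvDensity

open MeasureTheory

variable {n j k : ℕ} {β : ℝ}

theorem integrableOn_atom (β : ℝ) (k : ℕ) : IntegrableOn (atom β k) (Set.Ico 0 1) :=
  (integrableOn_const (by simp)).indicator measurableSet_Ico

theorem dominantCoeff_atomSeq (n : ℕ) (β x : ℝ) :
    dominantCoeff n β (atomSeq n β x) =
      (∑ k ∈ Finset.range n, partialSum β (k + 1) * atom β (n - 1 - k) x) / weight n β := by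
  rw [dominantCoeff]
  congr 1
  exact Finset.sum_congr rfl fun k hk => by rw [atomSeq_of_lt (Finset.mem_range.1 hk)]

namespace IsPseudoGolden

variable (hβ : IsPseudoGolden n β)
include hβ

theorem pow_succ_sub_sum_eq (hj : j < n) :
    β ^ (j + 1) - ∑ i ∈ Finset.Icc 1 j, β ^ i = β * partialSum β (n - j) := by
  induction j with
  | zero => simp [hβ.partialSum_eq_one]
  | succ j ih =>
    have hshift : ∑ i ∈ Finset.Icc 1 (j + 1), β ^ i =
        β * (1 + ∑ i ∈ Finset.Icc 1 j, β ^ i) := by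
      rw [← Finset.Ico_add_one_right_eq_Icc, ← Finset.Ico_add_one_right_eq_Icc,
        Finset.sum_eq_sum_Ico_succ_bot (by omega), ← Finset.sum_Ico_add' _ 1 (j + 1) 1, mul_add,
        Finset.mul_sum]
      simp only [pow_zero, mul_one, pow_succ']
    have hmul := mul_partialSum_succ hβ.pos.ne' (n - (j + 1))
    rw [show n - (j + 1) + 1 = n - j by omega] at hmul
    rw [hshift, pow_succ']
    linear_combination β * ih (by omega) + β * hmul

theorem sum_stepFun (x : ℝ) :
    ∑ j ∈ Finset.Icc 1 n, stepFun β j x =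
      β * ∑ k ∈ Finset.range n, partialSum β (k + 1) * atom β (n - 1 - k) x := by
  rw [← Finset.sum_range_reflect fun k => partialSum β (k + 1) * atom β (n - 1 - k) x,
    Finset.mul_sum, ← Finset.Ico_add_one_right_eq_Icc, Finset.sum_Ico_eq_sum_range]
  refine Finset.sum_congr rfl fun i hi => ?_
  have hi := Finset.mem_range.1 hi
  rw [show n - 1 - (n - 1 - i) = i by omega, show n - 1 - i + 1 = n - i by omega,
    stepFun, add_comm 1 i, Nat.add_sub_cancel, hβ.pow_succ_sub_sum_eq (by omega), atom]
  simp only [Set.indicator_apply, Pi.one_apply]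
  split_ifs <;> ring

theorem setIntegral_atom (hk : k < n) :
    ∫ x in Set.Ico (0 : ℝ) 1, atom β k x = (β ^ (k + 1))⁻¹ := by
  have hsub : Set.Ico (partialSum β k) (partialSum β (k + 1)) ⊆ Set.Ico 0 1 :=
    Set.Ico_subset_Ico (partialSum_nonneg hβ.pos k) (hβ.partialSum_le_one hk)
  simp only [atom]
  rw [integral_indicator_one measurableSet_Ico, measureReal_restrict_apply measurableSet_Ico,
    Set.inter_eq_left.2 hsub,
    Real.volume_real_Ico_of_le ((partialSum_strictMono hβ.pos).monotone k.le_succ),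
    partialSum_succ, add_sub_cancel_left]

theorem pow_mul_normConst : β ^ n * normConst n β = β * weight n β := by
  simp only [normConst, hβ.sum_stepFun]
  rw [integral_const_mul, integral_finsetSum _ fun k _ => (integrableOn_atom β _).const_mul _,
    mul_left_comm, Finset.mul_sum, weight]
  congr 1
  refine Finset.sum_congr rfl fun k hk => ?_
  have hk := Finset.mem_range.1 hk
  have hpow : β ^ n = β ^ k * β ^ (n - 1 - k + 1) := by
    rw [← pow_add]
    congr 1
    omega
  have := hβ.pos
  rw [integral_const_mul, hβ.setIntegral_atom (by omega), hpow]
  field_simp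

theorem invDensity_eq (x : ℝ) :
    invDensity n β x = dominantCoeff n β (atomSeq n β x) * β ^ n := by
  have hpow := (pow_pos hβ.pos n).ne'
  have hW := (weight_pos (Nat.one_le_iff_ne_zero.1 hβ.one_le_order) hβ.pos).ne'
  have hβ₀ := hβ.pos.ne'
  have hD : normConst n β = β * weight n β / β ^ n := by
    rw [← hβ.pow_mul_normConst, mul_div_cancel_left₀ _ hpow]
  rw [invDensity, hβ.sum_stepFun, hD, dominantCoeff_atomSeq]
  field_simp

theorem abs_invDensity_le (x : ℝ) : |invDensity n β x| ≤ n / weight n β * β ^ n := by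
  have hW := weight_pos (Nat.one_le_iff_ne_zero.1 hβ.one_le_order) hβ.pos
  have hsum : |∑ k ∈ Finset.range n, partialSum β (k + 1) * atom β (n - 1 - k) x| ≤ n := by
    refine (Finset.abs_sum_le_sum_abs _ _).trans
      ((Finset.sum_le_card_nsmul _ _ 1 fun k hk => ?_).trans_eq (by simp))
    rw [abs_mul, abs_of_nonneg (partialSum_nonneg hβ.pos _)]
    exact mul_le_one₀ (hβ.partialSum_le_one (Finset.mem_range.1 hk)) (abs_nonneg _)
      (abs_atom_le_one _ _ _)
  rw [hβ.invDensity_eq, dominantCoeff_atomSeq, abs_mul, abs_div, abs_of_pos hW,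
    abs_of_pos (pow_pos hβ.pos n)]
  exact mul_le_mul_of_nonneg_right (div_le_div_of_nonneg_right hsum hW.le) (pow_pos hβ.pos n).le

theorem invDensity_mul_partialSum (m : ℕ) (hj : j ≤ n) (x : ℝ) :
    invDensity n β x * partialSum β j = (β ^ m)⁻¹ *
      ∑ i ∈ Finset.range j, dominantCoeff n β (atomSeq n β x) * β ^ (m + (n - 1 - i)) := by
  rw [hβ.invDensity_eq, partialSum_eq_sum_range, Finset.mul_sum, Finset.mul_sum]
  refine Finset.sum_congr rfl fun i hi => ?_
  have hi := Finset.mem_range.1 hi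
  have hpow : β ^ n = β ^ (i + 1) * β ^ (n - 1 - i) := by
    rw [← pow_add]
    congr 1
    omega
  have := hβ.pos
  rw [hpow, pow_add β m]
  field_simp

theorem exists_abs_transfer_pow_indicator_Ico_sub_le (hn : 2 ≤ n) {lam : Fin n → ℂ}
    (hlam : IsRootOrdering n lam) :
    ∃ C : ℝ, 0 ≤ C ∧ ∀ m : ℕ, ∀ j ≤ n, ∀ x ∈ Set.Ico (0 : ℝ) 1,
      |(transfer β ^ m) ((Set.Ico 0 (partialSum β j)).indicator 1) x -
        invDensity n β x * partialSum β j| ≤ C * (β⁻¹ * ‖lam ⟨1, hn⟩‖) ^ m := by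
  obtain ⟨C, hC, hbound⟩ := exists_abs_sub_dominantCoeff_le hβ hn hlam
  set ρ := ‖lam ⟨1, hn⟩‖
  have : 0 ≤ ρ := norm_nonneg _
  refine ⟨C * ∑ i ∈ Finset.range n, ρ ^ (n - 1 - i), by positivity, fun m j hj x hx => ?_⟩
  have hβm : 0 < (β ^ m)⁻¹ := inv_pos.2 (pow_pos hβ.pos m)
  have hterm (k : ℕ) : |atomSeq n β x k - dominantCoeff n β (atomSeq n β x) * β ^ k| ≤ C * ρ ^ k :=
    hbound _ (isSolution_atomSeq n β x)
      (fun k hk => atomSeq_of_lt hk β x ▸ abs_atom_le_one _ _ _) k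
  rw [hβ.transfer_pow_indicator_Ico m hj hx, hβ.invDensity_mul_partialSum m hj, ← mul_sub,
    ← Finset.sum_sub_distrib, abs_mul, abs_of_pos hβm]
  calc (β ^ m)⁻¹ * |∑ i ∈ Finset.range j, (atomSeq n β x (m + (n - 1 - i)) -
          dominantCoeff n β (atomSeq n β x) * β ^ (m + (n - 1 - i)))|
      ≤ (β ^ m)⁻¹ * ∑ i ∈ Finset.range j, C * ρ ^ (m + (n - 1 - i)) := by
        gcongr
        exact (Finset.abs_sum_le_sum_abs _ _).trans (Finset.sum_le_sum fun i _ => hterm _)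
    _ ≤ (β ^ m)⁻¹ * ∑ i ∈ Finset.range n, C * ρ ^ (m + (n - 1 - i)) := by
        gcongr
    _ = (C * ∑ i ∈ Finset.range n, ρ ^ (n - 1 - i)) * (β⁻¹ * ρ) ^ m := by
        simp only [pow_add, mul_pow, inv_pow, Finset.mul_sum, Finset.sum_mul]
        exact Finset.sum_congr rfl fun i _ => by ring

theorem exists_transfer_pow_one_le (hn : 2 ≤ n) {lam : Fin n → ℂ}
    (hlam : IsRootOrdering n lam) :
    ∃ B : ℝ, 0 ≤ B ∧ ∀ m : ℕ, ∀ x ∈ Set.Ico (0 : ℝ) 1, (transfer β ^ m) 1 x ≤ B := by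
  obtain ⟨C, hC, hbound⟩ := hβ.exists_abs_transfer_pow_indicator_Ico_sub_le hn hlam
  have hW := weight_pos (Nat.one_le_iff_ne_zero.1 hβ.one_le_order) hβ.pos
  have := hβ.pos
  refine ⟨n / weight n β * β ^ n + C, by positivity, fun m x hx => ?_⟩
  have hone : (transfer β ^ m) ((Set.Ico 0 (partialSum β n)).indicator 1) x =
      (transfer β ^ m) 1 x :=
    transfer_pow_congr hβ.one_le m
      (hβ.partialSum_eq_one.symm ▸ fun y hy => Set.indicator_of_mem hy _) hx
  have hρ : β⁻¹ * ‖lam ⟨1, hn⟩‖ ≤ 1 := (inv_mul_le_one₀ hβ.pos).2 (hlam.norm_le hβ _)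
  have hdiff := (le_abs_self _).trans (hbound m n le_rfl x hx)
  rw [hone, hβ.partialSum_eq_one, mul_one] at hdiff
  have hdecay : C * (β⁻¹ * ‖lam ⟨1, hn⟩‖) ^ m ≤ C :=
    mul_le_of_le_one_right hC (pow_le_one₀ (by positivity) hρ)
  linarith [(le_abs_self _).trans (hβ.abs_invDensity_le x)]

end IsPseudoGolden

end InvDensity

/-! ### Approximation by step functions -/

section StepApprox

open MeasureTheory

variable {n m k : ℕ} {β : ℝ} {g : ℝ → ℝ} {L ε B x : ℝ}

/-- The density `g_m` with `g` frozen at the left ends of the cylinder intervals of length `m`. -/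
noncomputable def stepApprox (n : ℕ) (β : ℝ) (g : ℝ → ℝ) (m : ℕ) : ℝ → ℝ :=
  ∑ J ∈ Omega n m, ((β ^ m)⁻¹ * g (leftEnd β J)) •
    (Set.Ico 0 (scaledLength n β J)).indicator 1

/-- The Riemann sum of `g` over the cylinder intervals of length `m`, with nodes at their left
ends; it is the integral of `stepApprox n β g m` over `[0, 1)`. -/
noncomputable def stepMass (n : ℕ) (β : ℝ) (g : ℝ → ℝ) (m : ℕ) : ℝ :=
  ∑ J ∈ Omega n m, (β ^ m)⁻¹ * g (leftEnd β J) * scaledLength n β J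

theorem stepApprox_apply (n : ℕ) (β : ℝ) (g : ℝ → ℝ) (m : ℕ) (x : ℝ) :
    stepApprox n β g m x = ∑ J ∈ Omega n m,
      (β ^ m)⁻¹ * g (leftEnd β J) * (Set.Ico 0 (scaledLength n β J)).indicator 1 x := by
  simp only [stepApprox, Finset.sum_apply, Pi.smul_apply, smul_eq_mul]

theorem nonneg_of_abs_sub_le_mul (hg : ∀ x ∈ Set.Ico (0 : ℝ) 1, ∀ y ∈ Set.Ico (0 : ℝ) 1,
    |g x - g y| ≤ L * |x - y|) : 0 ≤ L := by
  have h := (abs_nonneg _).trans (hg (1 / 2) (by norm_num) 0 (by norm_num))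
  rw [sub_zero] at h
  exact nonneg_of_mul_nonneg_left h (by norm_num)

theorem intervalIntegrable_indicator_Ico (a b : ℝ) :
    IntervalIntegrable ((Set.Ico a b).indicator (1 : ℝ → ℝ)) volume 0 1 :=
  (intervalIntegrable_iff_integrableOn_Ico_of_le zero_le_one).2
    ((integrableOn_const (by simp)).indicator measurableSet_Ico)

theorem integral_indicator_Ico_zero {a : ℝ} (ha₀ : 0 ≤ a) (ha₁ : a ≤ 1) :
    ∫ x in (0 : ℝ)..1, (Set.Ico 0 a).indicator (1 : ℝ → ℝ) x = a := by
  rw [intervalIntegral.integral_of_le zero_le_one, ← integral_Ico_eq_integral_Ioc,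
    integral_indicator_one measurableSet_Ico, measureReal_restrict_apply measurableSet_Ico,
    Set.inter_eq_left.2 (Set.Ico_subset_Ico_right ha₁), Real.volume_real_Ico_of_le ha₀, sub_zero]

theorem intervalIntegrable_stepApprox (n : ℕ) (β : ℝ) (g : ℝ → ℝ) (m : ℕ) :
    IntervalIntegrable (stepApprox n β g m) volume 0 1 :=
  IntervalIntegrable.sum _ fun _ _ => (intervalIntegrable_indicator_Ico _ _).smul _

theorem IsLipschitzDensity.intervalIntegrable (hg : IsLipschitzDensity g L) :
    IntervalIntegrable g volume 0 1 := by
  rw [intervalIntegrable_iff_integrableOn_Ico_of_le zero_le_one]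
  exact Integrable.of_integral_ne_zero (hg.integral_eq_one.trans_ne one_ne_zero)

theorem IsLipschitzDensity.intervalIntegral_eq_one (hg : IsLipschitzDensity g L) :
    ∫ x in (0 : ℝ)..1, g x = 1 := by
  rw [intervalIntegral.integral_of_le zero_le_one, ← integral_Ico_eq_integral_Ioc,
    hg.integral_eq_one]

namespace IsPseudoGolden

variable (hβ : IsPseudoGolden n β)
include hβ

theorem integral_stepApprox (g : ℝ → ℝ) (m : ℕ) :
    ∫ x in (0 : ℝ)..1, stepApprox n β g m x = stepMass n β g m := by
  simp only [stepApprox_apply]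
  rw [intervalIntegral.integral_finsetSum fun J _ =>
    (intervalIntegrable_indicator_Ico _ _).const_mul _, stepMass]
  exact Finset.sum_congr rfl fun J _ => by
    rw [intervalIntegral.integral_const_mul, integral_indicator_Ico_zero
      (hβ.scaledLength_nonneg J) (hβ.scaledLength_le_one J)]

theorem inv_le_scaledLength {J : Fin m → Bool} (hJ : J ∈ admissible n m) :
    β⁻¹ ≤ scaledLength n β J :=
  inv_le_partialSum hβ.pos (Nat.sub_pos_of_lt (trailingOnes_lt_of_mem hJ))

theorem leftEnd_mem_Ico {J : Fin m → Bool} (hJ : J ∈ admissible n m) :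
    leftEnd β J ∈ Set.Ico (0 : ℝ) 1 := by
  simpa using hβ.leftEnd_add_mem_Ico hJ
    ⟨le_rfl, (inv_pos.2 hβ.pos).trans_le (hβ.inv_le_scaledLength hJ)⟩

theorem abs_pushDensity_sub_stepApprox_le
    (hg : ∀ x ∈ Set.Ico (0 : ℝ) 1, ∀ y ∈ Set.Ico (0 : ℝ) 1, |g x - g y| ≤ L * |x - y|)
    (m : ℕ) (hx : x ∈ Set.Ico (0 : ℝ) 1) :
    |pushDensity n β g m x - stepApprox n β g m x| ≤ L * (β ^ m)⁻¹ * (transfer β ^ m) 1 x := by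
  have hscale : 0 < (β ^ m)⁻¹ := inv_pos.2 (pow_pos hβ.pos m)
  rw [← hβ.pushDensity_eq_transfer_pow 1 m hx, pushDensity, pushDensity, stepApprox_apply,
    Finset.mul_sum, ← Finset.sum_sub_distrib, Finset.mul_sum, Finset.mul_sum]
  refine (Finset.abs_sum_le_sum_abs _ _).trans (Finset.sum_le_sum fun J hJ => ?_)
  rw [mem_Omega] at hJ
  by_cases hxJ : x ∈ Set.Ico 0 (scaledLength n β J)
  · have hlip : |g (leftEnd β J + (β ^ m)⁻¹ * x) - g (leftEnd β J)| ≤ L * (β ^ m)⁻¹ := by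
      refine (hg _ (hβ.leftEnd_add_mem_Ico hJ hxJ) _ (hβ.leftEnd_mem_Ico hJ)).trans
        (mul_le_mul_of_nonneg_left ?_ (nonneg_of_abs_sub_le_mul hg))
      rw [add_sub_cancel_left, abs_of_nonneg (mul_nonneg hscale.le hx.1)]
      exact mul_le_of_le_one_right hscale.le hx.2.le
    simp only [Set.indicator_of_mem hxJ, Pi.one_apply, mul_one]
    rw [← mul_sub, abs_mul, abs_of_pos hscale, mul_comm]
    exact mul_le_mul_of_nonneg_right hlip hscale.le
  · simp [Set.indicator_of_notMem hxJ]

theorem abs_stepMass_sub_integral_le (hg_int : IntervalIntegrable g volume 0 1)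
    (hg : ∀ x ∈ Set.Ico (0 : ℝ) 1, ∀ y ∈ Set.Ico (0 : ℝ) 1, |g x - g y| ≤ L * |x - y|) (m : ℕ) :
    |stepMass n β g m - ∫ x in (0 : ℝ)..1, g x| ≤ L * (β ^ m)⁻¹ := by
  have hone : IntervalIntegrable (1 : ℝ → ℝ) volume 0 1 := intervalIntegrable_const
  have hPg := intervalIntegrable_transfer_pow hβ.one_le hβ.le_two hg_int m
  have hPone := intervalIntegrable_transfer_pow hβ.one_le hβ.le_two hone m
  have hmass : ∫ x in (0 : ℝ)..1, (transfer β ^ m) 1 x = 1 := by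
    simp [integral_transfer_pow hβ.one_le hβ.le_two hone]
  rw [← hβ.integral_stepApprox, ← integral_transfer_pow hβ.one_le hβ.le_two hg_int m,
    ← intervalIntegral.integral_sub (intervalIntegrable_stepApprox n β g m) hPg,
    ← Real.norm_eq_abs]
  calc ‖∫ x in (0 : ℝ)..1, (stepApprox n β g m x - (transfer β ^ m) g x)‖
      ≤ ∫ x in (0 : ℝ)..1, L * (β ^ m)⁻¹ * (transfer β ^ m) 1 x := by
        refine intervalIntegral.norm_integral_le_of_norm_le zero_le_one ?_ (hPone.const_mul _)
        filter_upwards [Measure.ae_ne volume 1] with x hx₁ hx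
        have hx : x ∈ Set.Ico (0 : ℝ) 1 := ⟨hx.1.le, hx.2.lt_of_ne hx₁⟩
        rw [← hβ.pushDensity_eq_transfer_pow g m hx, norm_sub_rev]
        exact hβ.abs_pushDensity_sub_stepApprox_le hg m hx
    _ = L * (β ^ m)⁻¹ := by rw [intervalIntegral.integral_const_mul, hmass, mul_one]

theorem abs_pushDensity_add_sub_transfer_pow_stepApprox_le
    (hg : ∀ x ∈ Set.Ico (0 : ℝ) 1, ∀ y ∈ Set.Ico (0 : ℝ) 1, |g x - g y| ≤ L * |x - y|)
    (m k : ℕ) (hx : x ∈ Set.Ico (0 : ℝ) 1) :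
    |pushDensity n β g (m + k) x - (transfer β ^ k) (stepApprox n β g m) x| ≤
      L * (β ^ m)⁻¹ * (transfer β ^ (m + k)) 1 x := by
  have hbound := abs_transfer_pow_le hβ.one_le k
    (r := (transfer β ^ m) g - stepApprox n β g m)
    (s := (L * (β ^ m)⁻¹) • (transfer β ^ m) 1) (fun y hy => by
      rw [Pi.sub_apply, ← hβ.pushDensity_eq_transfer_pow g m hy]
      exact hβ.abs_pushDensity_sub_stepApprox_le hg m hy) x hx
  rw [map_sub, map_smul, ← Module.End.mul_apply, ← Module.End.mul_apply, ← pow_add,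
    add_comm k m, Pi.sub_apply, ← hβ.pushDensity_eq_transfer_pow g (m + k) hx] at hbound
  exact hbound

theorem abs_transfer_pow_stepApprox_sub_le (hg : ∀ x ∈ Set.Ico (0 : ℝ) 1, 0 ≤ g x)
    (hε : ∀ j ≤ n, |(transfer β ^ k) ((Set.Ico 0 (partialSum β j)).indicator 1) x -
      invDensity n β x * partialSum β j| ≤ ε) (m : ℕ) :
    |(transfer β ^ k) (stepApprox n β g m) x - invDensity n β x * stepMass n β g m| ≤
      ε * (β * stepMass n β g m) := by
  have hε₀ : 0 ≤ ε := (abs_nonneg _).trans (hε 0 n.zero_le)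
  rw [stepApprox, map_sum, Finset.sum_apply, stepMass, Finset.mul_sum, ← Finset.sum_sub_distrib,
    Finset.mul_sum, Finset.mul_sum]
  refine (Finset.abs_sum_le_sum_abs _ _).trans (Finset.sum_le_sum fun J hJ => ?_)
  rw [mem_Omega] at hJ
  have hcoeff : 0 ≤ (β ^ m)⁻¹ * g (leftEnd β J) :=
    mul_nonneg (inv_pos.2 (pow_pos hβ.pos m)).le (hg _ (hβ.leftEnd_mem_Ico hJ))
  have hlength : 1 ≤ β * scaledLength n β J :=
    (inv_le_iff_one_le_mul₀' hβ.pos).1 (hβ.inv_le_scaledLength hJ)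
  rw [map_smul, Pi.smul_apply, smul_eq_mul, mul_left_comm, ← mul_sub, abs_mul,
    abs_of_nonneg hcoeff, mul_left_comm β, mul_left_comm ε]
  exact mul_le_mul_of_nonneg_left
    ((hε _ (Nat.sub_le _ _)).trans (le_mul_of_one_le_right hε₀ hlength)) hcoeff

theorem abs_pushDensity_add_sub_invDensity_le (hg : IsLipschitzDensity g L)
    (hx : x ∈ Set.Ico (0 : ℝ) 1) (hB : (transfer β ^ (m + k)) 1 x ≤ B)
    (hε : ∀ j ≤ n, |(transfer β ^ k) ((Set.Ico 0 (partialSum β j)).indicator 1) x -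
      invDensity n β x * partialSum β j| ≤ ε) :
    |pushDensity n β g (m + k) x - invDensity n β x| ≤
      (B + n / weight n β * β ^ n + ε * β) * (β ^ m)⁻¹ * L + ε * β := by
  have hβ₀ := hβ.pos
  have hε₀ : 0 ≤ ε := (abs_nonneg _).trans (hε 0 n.zero_le)
  have hL := nonneg_of_abs_sub_le_mul hg.lipschitz
  set f := invDensity n β x
  set S := stepMass n β g m
  set E := L * (β ^ m)⁻¹ with hE
  have hE₀ : 0 ≤ E := by positivity
  have hfreeze := (hβ.abs_pushDensity_add_sub_transfer_pow_stepApprox_le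
    hg.lipschitz m k hx).trans (mul_le_mul_of_nonneg_left hB hE₀)
  have hS : |S - 1| ≤ E := hg.intervalIntegral_eq_one ▸
    hβ.abs_stepMass_sub_integral_le hg.intervalIntegrable hg.lipschitz m
  have hfS : |f * S - f| ≤ n / weight n β * β ^ n * E := by
    rw [← mul_sub_one, abs_mul]
    exact mul_le_mul (hβ.abs_invDensity_le x) hS (abs_nonneg _)
      ((abs_nonneg _).trans (hβ.abs_invDensity_le x))
  have hstep : |(transfer β ^ k) (stepApprox n β g m) x - f * S| ≤ ε * (β * (1 + E)) := by
    refine (hβ.abs_transfer_pow_stepApprox_sub_le hg.nonneg hε m).trans ?_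
    gcongr
    linarith [(abs_le.1 hS).2]
  calc |pushDensity n β g (m + k) x - f|
      ≤ |pushDensity n β g (m + k) x - (transfer β ^ k) (stepApprox n β g m) x| +
        (|(transfer β ^ k) (stepApprox n β g m) x - f * S| + |f * S - f|) :=
        (abs_sub_le _ _ _).trans (by gcongr; exact abs_sub_le _ _ _)
    _ ≤ E * B + (ε * (β * (1 + E)) + n / weight n β * β ^ n * E) := by gcongr
    _ = (B + n / weight n β * β ^ n + ε * β) * (β ^ m)⁻¹ * L + ε * β := by
        rw [hE]
        ring

end IsPseudoGolden

end StepApprox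

end PseudoGolden

open PseudoGolden in
theorem mainTheorem3_general (n : ℕ) (hn : 2 ≤ n) (β : ℝ) (hβ_pos : 0 < β)
    (hβ : β ^ n = ∑ i ∈ Finset.range n, β ^ i)
    (lam : Fin n → ℂ) (hlam : IsRootOrdering n lam) :
    ∃ C₁ C₂ : ℝ, 0 ≤ C₁ ∧ 0 ≤ C₂ ∧
      ∀ (g : ℝ → ℝ) (L : ℝ), IsLipschitzDensity g L → ∀ m₁ m₂ : ℕ,
        supDist (pushDensity n β g (m₁ + m₂)) (invDensity n β) ≤
          ENNReal.ofReal (C₁ * (β ^ m₁)⁻¹ * L + C₂ * (β⁻¹ * ‖lam ⟨1, hn⟩‖) ^ m₂) := by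
  have hG : IsPseudoGolden n β := ⟨hβ_pos, hβ⟩
  obtain ⟨B, hB₀, hB⟩ := hG.exists_transfer_pow_one_le hn hlam
  obtain ⟨C, hC₀, hC⟩ := hG.exists_abs_transfer_pow_indicator_Ico_sub_le hn hlam
  have hW := weight_pos (n := n) (by omega) hβ_pos
  have hρ : β⁻¹ * ‖lam ⟨1, hn⟩‖ ≤ 1 := (inv_mul_le_one₀ hβ_pos).2 (hlam.norm_le hG _)
  refine ⟨B + n / weight n β * β ^ n + C * β, C * β, by positivity, by positivity, ?_⟩
  intro g L hg m₁ m₂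
  have hL := nonneg_of_abs_sub_le_mul hg.lipschitz
  have hdecay : C * (β⁻¹ * ‖lam ⟨1, hn⟩‖) ^ m₂ ≤ C :=
    mul_le_of_le_one_right hC₀ (pow_le_one₀ (by positivity) hρ)
  refine iSup₂_le fun x hx => ENNReal.ofReal_le_ofReal ?_
  refine (hG.abs_pushDensity_add_sub_invDensity_le hg hx (hB _ x hx)
    fun j hj => hC m₂ j hj x hx).trans ?_
  rw [mul_right_comm C β]
  gcongr

theorem mainTheorem3 (n : ℕ) (hn : 2 ≤ n) (β : ℝ) (hβ_pos : 0 < β)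
    (hβ : β ^ n = ∑ i ∈ Finset.range n, β ^ i)
    (lam : Fin n → ℂ) (hlam : PseudoGolden.IsRootOrdering n lam) :
    ∃ C₁ C₂ : ℝ, 0 ≤ C₁ ∧ 0 ≤ C₂ ∧
      ∀ (g : ℝ → ℝ) (L : ℝ), PseudoGolden.IsLipschitzDensity g L →
        ∀ m m₁ m₂ : ℕ, 2 * n < m → n - 1 ≤ m₁ → 2 * n - 1 < m₂ → m₁ + m₂ = m →
          PseudoGolden.supDist (PseudoGolden.pushDensity n β g m)
              (PseudoGolden.invDensity n β) ≤
            ENNReal.ofReal (C₁ * (β ^ m₁)⁻¹ * L + C₂ * (β⁻¹ * ‖lam ⟨1, hn⟩‖) ^ m₂) := by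
  obtain ⟨C₁, C₂, hC₁, hC₂, h⟩ := mainTheorem3_general n hn β hβ_pos hβ lam hlam
  exact ⟨C₁, C₂, hC₁, hC₂, fun g L hg _ m₁ m₂ _ _ _ hm => hm ▸ h g L hg m₁ m₂⟩
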